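/- Let $\Gamma$ be a finitely generated amenable (discrete) group, and let $(F_n)$ be any right Følner sequence of $\Gamma$, i.e. a sequence of nonempty finite subsets with $|F_nK\bigtriangleup F_n|/|F_n|\to 0$ for every nonempty finite $K\subset\Gamma$. Let $f=\sum_\gamma f_\gamma\gamma\in\mathbb Z\Gamma$ be such that $f$ is a unit in the convolution algebra $L^1(\Gamma)$ and is positive in the group von Neumann algebra $\mathcal N\Gamma=\mathcal B(L^2(\Gamma))^\Gamma$, i.e. the operator $r(f)\in\mathcal N\Gamma$, $(r(f)x)_{\gamma'}=\sum_\gamma f_\gamma x_{\gamma'\gamma}$, is positive. Let $$X_f=\widehat{\mathbb Z\Gamma/\mathbb Z\Gamma f}=\Big\{x\in(\mathbb R/\mathbb Z)^\Gamma : \sum_{\gamma}f_\gamma x_{\gamma'\gamma}=0\text{ for all }\gamma'\in\Gamma\Big\}$$ with the left action $(\gamma x)_{\gamma'}=x_{\gamma^{-1}\gamma'}$, and let $h_f$ be its topological entropy, $$h_f=\sup_{\mathfrak U}\ \lim_{n\to\infty}\frac1{|F_n|}\log N\Big(\bigvee_{\gamma\in F_n}\gamma\,\mathfrak U\Big),$$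 where $\mathfrak U$ runs over the open covers of $X_f$ and $N$ is the least cardinality of a subcover (it is known that the limits exist and do not depend on $(F_n)$; the inequality below is asserted with $\liminf$ in place of $\lim$, along every right Følner sequence). Then $$h_f\ \ge\ \log{\det}_{\mathcal N\Gamma} f ,$$ where $\det_{\mathcal N\Gamma} f=\exp\big(\tfrac12\operatorname{tr}_{\mathcal N\Gamma}\log (r(f)r(f)^*)\big)$ is the Fuglede–Kadison–Lück determinant, with $\operatorname{tr}_{\mathcal N\Gamma}(A)=(A e,e)$ and $e\in\Gamma\subset L^2(\Gamma)$ the unit element. -/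

import Mathlib

open scoped ENNReal Pointwise Topology symmDiff

noncomputable section

namespace Deninger

/-! ### Følner sequences and topological entropy -/

section Entropy

open Classical in
/-- A (right) Følner sequence: nonempty finite sets `F n` with `|F n * K ∆ F n| / |F n| → 0`
for every nonempty finite `K`. A finitely generated (more generally, countable) group is amenable
if and only if it has one. -/
structure IsFolnerSeq {Γ : Type*} [Group Γ] (F : ℕ → Finset Γ) : Prop where
  nonempty : ∀ n, (F n).Nonempty
  tendsto : ∀ K : Finset Γ, K.Nonempty →
    Filter.Tendsto (fun n => (((F n * K) ∆ F n).card : ℝ) / ((F n).card : ℝ))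
      Filter.atTop (𝓝 0)

variable {Γ X : Type*}

/-- `U` is an open cover of `X`. -/
def IsOpenCover [TopologicalSpace X] (U : Set (Set X)) : Prop :=
  (∀ u ∈ U, IsOpen u) ∧ ⋃₀ U = Set.univ

/-- `N(U)`: the cardinality of a smallest subcover of `U` (with value `⊤` if there is no finite
one, which does not happen for open covers of a compact space). -/
def minSubcover (U : Set (Set X)) : ℕ∞ :=
  ⨅ (V : Set (Set X)) (_ : V ⊆ U) (_ : ⋃₀ V = Set.univ), V.encard

/-- The common refinement `U^F = ⋁_{γ ∈ F} γ U`: all sets `⋂_{γ ∈ F} γ u_γ` with `u_γ ∈ U`. -/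
def coverJoin [SMul Γ X] (F : Finset Γ) (U : Set (Set X)) : Set (Set X) :=
  {W | ∃ u : Γ → Set X, (∀ γ ∈ F, u γ ∈ U) ∧ W = ⋂ γ ∈ F, γ • u γ}

/-- `h(U)`, the limit of `log N(U^{F n}) / |F n|`. For an open cover of a compact space and a
Følner sequence the limit exists and does not depend on the sequence; it is written as a
lower limit, so that a lower bound for it does not presuppose the existence of the limit. -/
def coverEntropyOf [SMul Γ X] (F : ℕ → Finset Γ) (U : Set (Set X)) : EReal :=
  Filter.liminf
    (fun n => ENNReal.log ((minSubcover (coverJoin (F n) U) : ℕ∞) : ℝ≥0∞) / ((F n).card : EReal))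
    Filter.atTop

/-- The topological entropy of the action of `Γ` on `X`, computed along `F`: the supremum of
`h(U)` over all open covers `U` of `X`. -/
def topEntropy (F : ℕ → Finset Γ) (X : Type*) [TopologicalSpace X] [SMul Γ X] : EReal :=
  ⨆ (U : Set (Set X)) (_ : IsOpenCover U), coverEntropyOf F U

end Entropy

/-! ### The dynamical system `X_f` -/

section System

variable {Γ : Type*} [Group Γ]

/-- Right multiplication by `f^*` on formal series `ℝ/ℤ[|Γ|]`:
`(x f^*)_γ = ∑_s f_s x_{γ s}`. -/
def mulStarRight (f : MonoidAlgebra ℤ Γ) : (Γ → UnitAddCircle) →+ (Γ → UnitAddCircle) where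
  toFun x γ := ∑ s ∈ f.coeff.support, f.coeff s • x (γ * s)
  map_zero' := by
    ext γ
    simp
  map_add' x y := by
    ext γ
    simp [Finset.sum_add_distrib]

/-- `X_f`, the kernel of right multiplication by `f^*` on `(ℝ/ℤ)^Γ`, with the topology of
`(ℝ/ℤ)^Γ`. It is the Pontryagin dual of `ℤΓ / ℤΓ f`, see `mem_dualSystem_iff`. -/
def dualSystem (f : MonoidAlgebra ℤ Γ) : AddSubgroup (Γ → UnitAddCircle) :=
  (mulStarRight f).ker

/-- The Pontryagin pairing `⟨a, x⟩ = ∑ a_γ x_γ` between `ℤΓ` and `(ℝ/ℤ)^Γ`. -/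
def pairing (x : Γ → UnitAddCircle) : MonoidAlgebra ℤ Γ →+ UnitAddCircle where
  toFun a := a.coeff.sum fun γ n => n • x γ
  map_zero' := by simp
  map_add' a b := by
    rw [MonoidAlgebra.coeff_add]
    exact Finsupp.sum_add_index' (by simp) (by intros; simp [add_smul])

/-- `X_f` is the annihilator of the left ideal `ℤΓ f` under the Pontryagin pairing. -/
theorem mem_dualSystem_iff (f : MonoidAlgebra ℤ Γ) (x : Γ → UnitAddCircle) :
    x ∈ dualSystem f ↔ ∀ a : MonoidAlgebra ℤ Γ, pairing x (a * f) = 0 := by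
  have key : ∀ (g : Γ) (h : MonoidAlgebra ℤ Γ),
      pairing x (MonoidAlgebra.single g 1 * h) = mulStarRight h x g := by
    intro g h
    change _ = pairing (fun s => x (g * s)) h
    have : (pairing x).comp (AddMonoidHom.mulLeft (MonoidAlgebra.single g (1 : ℤ))) =
        pairing (fun s => x (g * s)) := by
      ext s
      change (MonoidAlgebra.single g (1 : ℤ) * MonoidAlgebra.single s 1).coeff.sum
          (fun γ n => n • x γ) =
        (MonoidAlgebra.single s (1 : ℤ)).coeff.sum (fun γ n => n • x (g * γ))
      simp [MonoidAlgebra.single_mul_single]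
    exact DFunLike.congr_fun this h
  have hker : x ∈ dualSystem f ↔ mulStarRight f x = 0 := Iff.rfl
  rw [hker]
  constructor
  · intro hx a
    induction a using MonoidAlgebra.induction_linear with
    | zero => simp
    | add a b ha hb => rw [add_mul, map_add, ha, hb, add_zero]
    | single g n =>
      have : MonoidAlgebra.single g n = n • MonoidAlgebra.single g (1 : ℤ) := by
        simp
      rw [this, smul_mul_assoc, map_zsmul, key, hx]
      simp
  · intro h
    ext γ
    rw [← key]
    exact h _

/-- The left action `(γ x)_{γ'} = x_{γ⁻¹ γ'}` of `Γ` on `X_f`. -/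
instance (f : MonoidAlgebra ℤ Γ) : MulAction Γ (dualSystem f) where
  smul γ x := ⟨fun γ' => x.1 (γ⁻¹ * γ'), by
    have hx : mulStarRight f x.1 = 0 := x.2
    change mulStarRight f _ = 0
    ext γ'
    have := congrFun hx (γ⁻¹ * γ')
    simpa [mulStarRight, mul_assoc] using this⟩
  one_smul x := by
    apply Subtype.ext
    funext γ'
    change x.1 (1⁻¹ * γ') = x.1 γ'
    simp
  mul_smul a b x := by
    apply Subtype.ext
    funext γ'
    change x.1 ((a * b)⁻¹ * γ') = x.1 (b⁻¹ * (a⁻¹ * γ'))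
    simp [mul_assoc]

end System

/-! ### The group von Neumann algebra and the Fuglede–Kadison determinant -/

section VonNeumann

/-- The Hilbert space `L²(Γ)`. -/
abbrev L2 (Γ : Type*) := lp (fun _ : Γ => ℂ) 2

/-- The isometry `x ↦ x ∘ e` of `L²(Γ)`. -/
def permL2 {Γ : Type*} (e : Equiv.Perm Γ) : L2 Γ →L[ℂ] L2 Γ :=
  LinearMap.mkContinuous
    { toFun := fun x => ⟨fun γ => x (e γ), memℓp_gen (by
        simpa [Function.comp_def] using
          e.summable_iff.mpr ((lp.memℓp x).summable (by norm_num)))⟩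
      map_add' := fun _ _ => rfl
      map_smul' := fun _ _ => rfl } 1 (by
    intro x
    rw [one_mul]
    apply le_of_eq
    rw [lp.norm_eq_tsum_rpow (by norm_num), lp.norm_eq_tsum_rpow (by norm_num)]
    congr 1
    exact e.tsum_eq (fun γ => ‖x γ‖ ^ (2 : ℝ≥0∞).toReal))

variable {Γ : Type*} [Group Γ]

/-- The left translation `(γ x)_{γ'} = x_{γ⁻¹ γ'}` on `L²(Γ)`. -/
def leftShift (γ : Γ) : L2 Γ →L[ℂ] L2 Γ := permL2 (Equiv.mulLeft γ⁻¹)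

variable (Γ) in
/-- The group von Neumann algebra `𝒩Γ`: the bounded operators on `L²(Γ)` that commute with
all left translations. -/
def groupVN : Subalgebra ℂ (L2 Γ →L[ℂ] L2 Γ) :=
  Subalgebra.centralizer ℂ (Set.range (leftShift (Γ := Γ)))

/-- `γ ↦ R_{γ⁻¹}`, where `R_γ x = x γ`, so that `(R_{γ⁻¹} x)_{γ'} = x_{γ' γ}`. -/
def rightShift : Γ →* groupVN Γ where
  toFun γ := ⟨permL2 (Equiv.mulRight γ), by
    rw [groupVN, Subalgebra.mem_centralizer_iff]
    rintro _ ⟨s, rfl⟩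
    ext x γ'
    change x (s⁻¹ * γ' * γ) = x (s⁻¹ * (γ' * γ))
    rw [mul_assoc]⟩
  map_one' := by
    apply Subtype.ext
    ext x γ'
    change x (γ' * 1) = x γ'
    rw [mul_one]
  map_mul' a b := by
    apply Subtype.ext
    ext x γ'
    change x (γ' * (a * b)) = x (γ' * a * b)
    rw [mul_assoc]

/-- The ring homomorphism `r : ℤΓ → 𝒩Γ`, `∑ a_γ γ ↦ ∑ a_γ R_{γ⁻¹}`. -/
def toGroupVN : MonoidAlgebra ℤ Γ →ₐ[ℤ] groupVN Γ :=
  MonoidAlgebra.lift ℤ (groupVN Γ) Γ rightShift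

open Classical in
/-- The von Neumann trace `A ↦ (A e, e)`. -/
def vnTrace (A : L2 Γ →L[ℂ] L2 Γ) : ℂ :=
  inner ℂ (lp.single 2 (1 : Γ) (1 : ℂ) : L2 Γ) (A (lp.single 2 (1 : Γ) (1 : ℂ)))

/-- The Fuglede–Kadison–Lück determinant `exp (½ tr (log (u u^*)))` of a unit `u` of `𝒩Γ`;
`log` is that of the continuous functional calculus, and the trace of the self-adjoint
operator `log (u u^*)` is real. -/
def fkDet (u : groupVN Γ) : ℝ :=
  Real.exp (1 / 2 *
    (vnTrace (CFC.log ((u : L2 Γ →L[ℂ] L2 Γ) * star (u : L2 Γ →L[ℂ] L2 Γ)))).re)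

end VonNeumann

/-! ### Units of `L¹(Γ)` -/

section L1

variable {Γ : Type*} [Group Γ]

/-- The convolution product `(a b)_γ = ∑_s a_s b_{s⁻¹ γ}`; the series converges absolutely
for `a` and `b` in `L¹(Γ)`. -/
def conv (a b : Γ → ℂ) : Γ → ℂ := fun γ => ∑' s, a s * b (s⁻¹ * γ)

open Classical in
/-- `a` is a unit in the convolution algebra `L¹(Γ)`. -/
def IsUnitL1 (a : Γ → ℂ) : Prop :=
  Memℓp a 1 ∧ ∃ b : Γ → ℂ, Memℓp b 1 ∧ conv a b = Pi.single 1 1 ∧ conv b a = Pi.single 1 1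

end L1

end Deninger

end

/-!
Write `A = r(f)` and, for a finite set `F ⊆ Γ`, let `M_F` be the compression of `A` to the
coordinates in `F`, the integer matrix with entries `f_{g⁻¹ h}`. The proof compares both sides
with `log det M_F / |F|`.

*Determinants.* `A` is invertible, since the inverse of `f` in `L¹(Γ)` defines a right inverse of
`A` and `A` is self-adjoint. Concavity of the logarithm gives
`⟨x, (log A) x⟩ ≤ log ⟨x, A x⟩` for unit vectors `x` (`exp_inner_log_le`). Summing over an
eigenbasis of `M_F` (the Berezin–Peierls inequality, `exp_sum_inner_log_le_det`) yields
`tr (P_F (log A) P_F) ≤ log det M_F`. As `log A` commutes with the left translations, the left-hand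
side is `|F| tr_{𝒩Γ} (log A) = |F| log det_{𝒩Γ} f`. This holds for every finite `F`
(`exp_vnTrace_log_le_det`), so no approximation of the spectral measure of `A` is needed.

*Separated points.* The group `ℤ^F / M_F ℤ^F` has `det M_F` elements, and each class has a
representative `w` with `|w| ≤ ‖f‖₁`. Convolution of `w` with the `L¹`-inverse of `f`, reduced
modulo `1`, is a point `x_w` of `X_f`. Suppose that `x_w` and `x_{w'}` are closer than
`1 / (‖f‖₁ + 1)` at all coordinates in `F`, and let `v` be the rounding on `F` of the difference of
the real lifts. Then `w - w' - M_F v` is an integer vector bounded independently of `F` and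
of absolute value `< 1`, so zero, off the boundary of `F`. Hence at most
`(2C + 1)^|∂F|` of the points `x_w` lie in one element of the refined cover, and
`det M_F ≤ N(U^F) (2C + 1)^|∂F|` (`exists_det_le_ncard`). Along a Følner sequence
`|∂F| / |F| → 0`, which gives the inequality.
-/

namespace Deninger

/-! ### The Berezin–Peierls inequality for the logarithm -/

section Berezin

variable {H : Type*} [NormedAddCommGroup H] [InnerProductSpace ℂ H] [CompleteSpace H]

/-- Jensen's inequality `⟨x, (log A) x⟩ ≤ log ⟨x, A x⟩` for a unit vector `x`. With
`l = ⟨x, (log A) x⟩`, it is the value at `x` of the tangent line estimate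
`log A ≤ e^{-l} A + l - 1`. -/
theorem exp_inner_log_le {A : H →L[ℂ] H} (hA : A.IsPositive) (hu : IsUnit A) {x : H}
    (hx : ‖x‖ = 1) :
    Real.exp (inner ℂ x (CFC.log A x)).re ≤ (inner ℂ x (A x)).re := by
  set l := (inner ℂ x (CFC.log A x)).re with hl
  have h0 : 0 ≤ A := (ContinuousLinearMap.nonneg_iff_isPositive A).2 hA
  have hsa : IsSelfAdjoint A := hA.isSelfAdjoint
  have hspec : ∀ t ∈ spectrum ℝ A, 0 < t := fun t ht =>
    lt_of_le_of_ne (spectrum_nonneg_of_nonneg h0 ht) fun h =>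
      spectrum.zero_notMem ℝ hu (h ▸ ht)
  have hle : CFC.log A ≤ cfc (fun t : ℝ => Real.exp (-l) * t + (l - 1)) A := by
    refine cfc_mono (fun t ht => ?_) ?_ (by fun_prop)
    · have ht := hspec t ht
      have := Real.log_le_sub_one_of_pos (mul_pos (Real.exp_pos (-l)) ht)
      rw [Real.log_mul (Real.exp_pos _).ne' ht.ne', Real.log_exp] at this
      linarith
    · exact Real.continuousOn_log.mono fun t ht => (hspec t ht).ne'
  have hcfc : cfc (fun t : ℝ => Real.exp (-l) * t + (l - 1)) A =
      Real.exp (-l) • A + algebraMap ℝ (H →L[ℂ] H) (l - 1) := by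
    rw [cfc_add_const (l - 1) (fun t : ℝ => Real.exp (-l) * t) A, cfc_const_mul_id _ A]
  rw [hcfc] at hle
  have h1 := ((ContinuousLinearMap.le_def _ _).1 hle).re_inner_nonneg_right x
  have h2 : (inner ℂ x x).re = 1 := by
    rw [inner_self_eq_norm_sq_to_K, hx]; simp
  have h3 : l ≤ Real.exp (-l) * (inner ℂ x (A x)).re + (l - 1) := by
    have h4 : inner ℂ x ((Real.exp (-l) • A + algebraMap ℝ (H →L[ℂ] H) (l - 1) - CFC.log A) x) =
      (Real.exp (-l) : ℂ) * inner ℂ x (A x) + ((l - 1 : ℝ) : ℂ) * inner ℂ x x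
        - inner ℂ x (CFC.log A x) := by
      rw [Algebra.algebraMap_eq_smul_one]
      simp only [sub_apply, add_apply, smul_apply, inner_sub_right, inner_add_right,
        one_apply_eq_self, RCLike.real_smul_eq_coe_smul (K := ℂ), inner_smul_right]
      simp
    rw [h4] at h1
    simp only [RCLike.re_to_complex, Complex.sub_re, Complex.add_re, Complex.re_ofReal_mul, h2,
      mul_one, ← hl] at h1
    linarith
  rw [Real.exp_neg] at h3
  have h5 : 1 ≤ (inner ℂ x (A x)).re / Real.exp l := by
    rw [div_eq_inv_mul]; linarith
  rwa [one_le_div (Real.exp_pos l)] at h5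

theorem commute_log {A B : H →L[ℂ] H} (h : Commute A B) : Commute (CFC.log A) B :=
  h.cfc_real Real.log

/-- The Berezin–Peierls inequality `tr (V^* (log A) V) ≤ log det (V^* A V)` for an isometry `V`
from a finite-dimensional space, with `S = V^* A V`. -/
theorem exp_sum_inner_log_le_det {E ι : Type*} [NormedAddCommGroup E] [InnerProductSpace ℂ E]
    [FiniteDimensional ℂ E] [Fintype ι] {A : H →L[ℂ] H} (hA : A.IsPositive) (hu : IsUnit A)
    (V : E →ₗᵢ[ℂ] H) (S : E →ₗ[ℂ] E) (hS : ∀ u v, inner ℂ u (S v) = inner ℂ (V u) (A (V v)))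
    (b : OrthonormalBasis ι ℂ E) :
    ∃ d : ℝ, LinearMap.det S = d ∧
      Real.exp (∑ i, inner ℂ (V (b i)) (CFC.log A (V (b i)))).re ≤ d := by
  have hsym : S.IsSymmetric := fun u v => by
    rw [hS, ← inner_conj_symm, hS, inner_conj_symm]
    exact hA.isSymmetric _ _
  have hev : ∀ i, hsym.eigenvalues rfl i =
      (inner ℂ (V (hsym.eigenvectorBasis rfl i)) (A (V (hsym.eigenvectorBasis rfl i)))).re := by
    intro i
    rw [← hS, hsym.apply_eigenvectorBasis, inner_smul_right, inner_self_eq_norm_sq_to_K]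
    simp
  refine ⟨∏ i, hsym.eigenvalues rfl i, ?_, ?_⟩
  · rw [hsym.det_eq_prod_eigenvalues rfl]
    simp
  -- The trace of `V^* (log A) V` is independent of the basis, so it may be taken over the
  -- eigenvectors of `S`.
  let T : E →ₗ[ℂ] E :=
    (V.toContinuousLinearMap.adjoint ∘L CFC.log A ∘L V.toContinuousLinearMap).toLinearMap
  have hT : ∀ u v, inner ℂ u (T v) = inner ℂ (V u) (CFC.log A (V v)) := fun u v => by
    change inner ℂ u (V.toContinuousLinearMap.adjoint (CFC.log A (V v))) = _
    rw [ContinuousLinearMap.adjoint_inner_right]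
    rfl
  have htr := (T.trace_eq_sum_inner b).symm.trans
    (T.trace_eq_sum_inner (hsym.eigenvectorBasis rfl))
  simp only [hT] at htr
  rw [htr, Complex.re_sum, Real.exp_sum]
  refine Finset.prod_le_prod (fun i _ => (Real.exp_pos _).le) fun i _ => ?_
  rw [hev]
  exact exp_inner_log_le hA hu (by simp)

end Berezin

/-! ### Right multiplication by `f^*` on `L²(Γ)` and its compressions -/

section L2

variable {Γ : Type*}

theorem norm_permL2_le (e : Equiv.Perm Γ) : ‖permL2 e‖ ≤ 1 :=
  LinearMap.mkContinuous_norm_le _ zero_le_one _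

open Classical in
/-- The unit vector of `L²(Γ)` at `γ`. -/
noncomputable def delta (γ : Γ) : L2 Γ := lp.single 2 γ (1 : ℂ)

theorem inner_delta_left (γ : Γ) (x : L2 Γ) : inner ℂ (delta γ) x = x γ := by
  classical
  simp [delta, lp.inner_single_left]

open Classical in
theorem delta_apply (γ γ' : Γ) : delta γ γ' = if γ' = γ then 1 else 0 := by
  rw [delta, lp.single_apply, Pi.single_apply]

theorem orthonormal_delta : Orthonormal ℂ (delta : Γ → L2 Γ) := by
  classical
  rw [orthonormal_iff_ite]
  intro i j
  rw [inner_delta_left, delta_apply]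

variable [Group Γ]

/-- The identity `f b = 1` in `L¹(Γ)`, evaluated on a bounded function with values in a Banach
space. It is used both for the translations of `L²(Γ)` and for bounded integer sequences. -/
theorem sum_smul_tsum_smul [DecidableEq Γ]
    {E : Type*} [NormedAddCommGroup E] [NormedSpace ℂ E] [CompleteSpace E]
    (f : MonoidAlgebra ℤ Γ) {b : Γ → ℂ} (hb : Summable fun γ => ‖b γ‖)
    (hfb : conv (fun γ => (f.coeff γ : ℂ)) b = Pi.single 1 1)
    {φ : Γ → E} {C : ℝ} (hφ : ∀ γ, ‖φ γ‖ ≤ C) :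
    ∑ s ∈ f.coeff.support, (f.coeff s : ℂ) • ∑' t, b t • φ (s * t) = φ 1 := by
  have hs : ∀ s, Summable fun t => b (s⁻¹ * t) • φ t := fun s => by
    refine Summable.of_norm_bounded
      (((Equiv.mulLeft s⁻¹).summable_iff.2 hb).mul_right C) fun t => ?_
    rw [norm_smul]
    exact mul_le_mul_of_nonneg_left (hφ t) (norm_nonneg _)
  have h1 : ∀ s, ∑' t, b t • φ (s * t) = ∑' t, b (s⁻¹ * t) • φ t := fun s => by
    rw [← (Equiv.mulLeft s).tsum_eq fun t => b (s⁻¹ * t) • φ t]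
    simp
  have h2 : ∀ γ, ∑ s ∈ f.coeff.support, (f.coeff s : ℂ) * b (s⁻¹ * γ) =
      (Pi.single 1 1 : Γ → ℂ) γ := by
    intro γ
    rw [← hfb, conv, tsum_eq_sum]
    intro s hs
    simp [Finsupp.notMem_support_iff.1 hs]
  simp only [h1, ← (hs _).tsum_const_smul]
  rw [← Summable.tsum_finsetSum fun s _ => (hs s).const_smul _]
  simp only [smul_smul, ← Finset.sum_smul, h2]
  rw [tsum_eq_single 1]
  · simp
  · intro γ hγ
    simp [hγ]

theorem toGroupVN_eq (f : MonoidAlgebra ℤ Γ) :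
    (toGroupVN f : L2 Γ →L[ℂ] L2 Γ) =
      ∑ s ∈ f.coeff.support, (f.coeff s : ℂ) • (rightShift s : L2 Γ →L[ℂ] L2 Γ) := by
  rw [toGroupVN, MonoidAlgebra.lift_apply, Finsupp.sum, AddSubmonoidClass.coe_finsetSum]
  refine Finset.sum_congr rfl fun s _ => ?_
  rw [Int.cast_smul_eq_zsmul]
  rfl

/-- A right inverse is `∑ b_t R_{t⁻¹}`, where `b` is the inverse of `f` in `L¹(Γ)`; by
self-adjointness its adjoint is a left inverse. -/
theorem isUnit_toGroupVN {f : MonoidAlgebra ℤ Γ}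
    (hunit : IsUnitL1 (fun γ => (f.coeff γ : ℂ)))
    (hf : IsSelfAdjoint (toGroupVN f : L2 Γ →L[ℂ] L2 Γ)) :
    IsUnit (toGroupVN f : L2 Γ →L[ℂ] L2 Γ) := by
  obtain ⟨-, b, hb, hfb, -⟩ := hunit
  have hb' : Summable fun γ => ‖b γ‖ := by simpa using hb.summable (by simp)
  have hR : ∀ γ : Γ, ‖(rightShift γ : L2 Γ →L[ℂ] L2 Γ)‖ ≤ 1 := fun γ => norm_permL2_le _
  have hs : Summable fun t => b t • (rightShift t : L2 Γ →L[ℂ] L2 Γ) :=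
    Summable.of_norm_bounded hb' fun t => by
      rw [norm_smul]
      exact mul_le_of_le_one_right (norm_nonneg _) (hR t)
  classical
  have key : (toGroupVN f : L2 Γ →L[ℂ] L2 Γ) *
      (∑' t, b t • (rightShift t : L2 Γ →L[ℂ] L2 Γ)) = 1 := by
    have := sum_smul_tsum_smul f hb' (by convert hfb) hR
    rw [map_one] at this
    refine Eq.trans ?_ this
    rw [toGroupVN_eq, Finset.sum_mul]
    refine Finset.sum_congr rfl fun s _ => ?_
    rw [smul_mul_assoc, ← hs.tsum_mul_left]
    congr 2
    ext1 t
    rw [mul_smul_comm, map_mul]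
    rfl
  have key' := congrArg star key
  rw [star_mul, hf.star_eq, star_one] at key'
  exact ⟨⟨_, _, key, left_inv_eq_right_inv key' key ▸ key'⟩, rfl⟩

theorem leftShift_delta (γ : Γ) : leftShift γ (delta 1) = delta γ := by
  ext γ'
  change delta 1 (γ⁻¹ * γ') = _
  rw [delta_apply, delta_apply]
  congr 1
  exact propext (inv_mul_eq_one.trans eq_comm)

theorem inner_delta_of_commute {T : L2 Γ →L[ℂ] L2 Γ} (hT : ∀ γ, Commute (leftShift γ) T) (γ : Γ) :
    inner ℂ (delta γ) (T (delta γ)) = vnTrace T := by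
  have h : T (leftShift γ (delta 1)) = leftShift γ (T (delta 1)) :=
    (congrArg (· (delta 1)) (hT γ).eq).symm
  rw [inner_delta_left, ← leftShift_delta, h]
  change T (delta 1) (γ⁻¹ * γ) = inner ℂ (delta 1) (T (delta 1))
  rw [inner_delta_left, inv_mul_cancel]

theorem inner_delta_toGroupVN (f : MonoidAlgebra ℤ Γ) (g h : Γ) :
    inner ℂ (delta g) ((toGroupVN f : L2 Γ →L[ℂ] L2 Γ) (delta h)) = (f.coeff (g⁻¹ * h) : ℂ) := by
  classical
  have h1 : ∀ s, (rightShift s : L2 Γ →L[ℂ] L2 Γ) (delta h) g = if s = g⁻¹ * h then 1 else 0 := by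
    intro s
    change delta h (g * s) = _
    simp [delta_apply, eq_inv_mul_iff_mul_eq]
  rw [inner_delta_left, ← inner_delta_left, toGroupVN_eq, sum_apply, inner_sum]
  simp only [smul_apply, inner_smul_right, inner_delta_left, h1]
  by_cases hz : f.coeff (g⁻¹ * h) = 0 <;> simp [hz]

/-- The matrix of the compression of `toGroupVN f` to the coordinates in `F`. -/
noncomputable def compression (f : MonoidAlgebra ℤ Γ) (F : Finset Γ) : Matrix F F ℤ :=
  Matrix.of fun g h => f.coeff ((g : Γ)⁻¹ * h)

/-- `|F| tr_{𝒩Γ} (log A) ≤ log det M_F` for every finite set `F`. -/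
theorem exp_vnTrace_log_le_det [DecidableEq Γ] {f : MonoidAlgebra ℤ Γ}
    (hpos : (toGroupVN f : L2 Γ →L[ℂ] L2 Γ).IsPositive)
    (hu : IsUnit (toGroupVN f : L2 Γ →L[ℂ] L2 Γ)) (F : Finset Γ) :
    Real.exp (F.card * (vnTrace (CFC.log (toGroupVN f : L2 Γ →L[ℂ] L2 Γ))).re) ≤
      ((compression f F).det : ℤ) := by
  set A : L2 Γ →L[ℂ] L2 Γ := (toGroupVN f : L2 Γ →L[ℂ] L2 Γ) with hA
  let b := EuclideanSpace.basisFun F ℂ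
  have hcomp : (b.toBasis.constr ℂ fun g : F => delta (g : Γ)) ∘ b.toBasis =
      fun g : F => delta (g : Γ) := by
    ext1 g
    simp only [Function.comp, Module.Basis.constr_basis]
  let V : EuclideanSpace ℂ F →ₗᵢ[ℂ] L2 Γ :=
    LinearMap.isometryOfOrthonormal (v := b.toBasis)
      (b.toBasis.constr ℂ fun g : F => delta (g : Γ)) (by simp)
      (by rw [hcomp]; exact orthonormal_delta.comp _ Subtype.val_injective)
  have hV : ∀ g, V (b g) = delta (g : Γ) := fun g => by
    have := congrFun hcomp g
    rwa [Function.comp, b.coe_toBasis] at this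
  let S : EuclideanSpace ℂ F →ₗ[ℂ] EuclideanSpace ℂ F :=
    (V.toContinuousLinearMap.adjoint ∘L A ∘L V.toContinuousLinearMap).toLinearMap
  have hS : ∀ u v, inner ℂ u (S v) = inner ℂ (V u) (A (V v)) := fun u v => by
    change inner ℂ u (V.toContinuousLinearMap.adjoint (A (V v))) = _
    rw [ContinuousLinearMap.adjoint_inner_right]
    rfl
  obtain ⟨d, hd, hle⟩ := exp_sum_inner_log_le_det hpos hu V S hS b
  have hdet : (d : ℂ) = ((compression f F).det : ℤ) := by
    rw [← hd, ← LinearMap.det_toMatrix b.toBasis, Int.cast_det]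
    congr 1
    ext g h
    rw [LinearMap.toMatrix_apply, b.coe_toBasis, b.coe_toBasis_repr_apply, b.repr_apply_apply,
      hS, hV, hV, inner_delta_toGroupVN]
    rfl
  have hdet' : d = ((compression f F).det : ℤ) := 
    Complex.ofReal_injective (hdet.trans (Complex.ofReal_intCast _).symm)
  rw [← hdet']
  refine le_trans (le_of_eq ?_) hle
  -- All diagonal entries of `log A` are equal to its trace, by left invariance.
  have hcomm : ∀ γ, Commute (leftShift γ) (CFC.log A) := fun γ => by
    have := (Subalgebra.mem_centralizer_iff ℂ).1 (toGroupVN f).2 (leftShift γ) ⟨γ, rfl⟩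
    exact (commute_log this.symm).symm
  simp only [hV, inner_delta_of_commute hcomm]
  simp

theorem log_fkDet {f : MonoidAlgebra ℤ Γ}
    (hpos : (toGroupVN f : L2 Γ →L[ℂ] L2 Γ).IsPositive)
    (hu : IsUnit (toGroupVN f : L2 Γ →L[ℂ] L2 Γ)) :
    Real.log (fkDet (toGroupVN f)) = (vnTrace (CFC.log (toGroupVN f : L2 Γ →L[ℂ] L2 Γ))).re := by
  rw [fkDet, Real.log_exp, hpos.isSelfAdjoint.star_eq, ← pow_two, CFC.log_pow 2 _
    (fun t ht h0 => spectrum.zero_notMem ℝ hu (h0 ▸ ht)) hpos.isSelfAdjoint]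
  simp [vnTrace, two_smul]
  ring

end L2

/-! ### Bounded representatives of `ℤ^ι / M ℤ^ι` -/

/-- A set of representatives `W` of `ℤ^ι / M ℤ^ι` bounded by any bound `L` on the absolute row
sums of `M`: the representatives lie in the parallelepiped `M [0, 1)^ι`. -/
theorem exists_representatives {ι : Type*} [Fintype ι] [DecidableEq ι] (M : Matrix ι ι ℤ)
    (hM : M.det ≠ 0) {L : ℝ} (hL : ∀ i, ∑ j, |(M i j : ℝ)| ≤ L) :
    ∃ W : Finset (ι → ℤ), W.card = M.det.natAbs ∧ (∀ w ∈ W, ∀ i, |(w i : ℝ)| ≤ L) ∧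
      ∀ w ∈ W, ∀ w' ∈ W, ∀ v, w - w' = M.mulVec v → w = w' := by
  classical
  let N : Submodule ℤ (ι → ℤ) := LinearMap.range (Matrix.toLin' M)
  have hinj : Function.Injective (Matrix.toLin' M) := by
    intro v v' h
    exact Matrix.mulVec_injective_of_det_ne_zero hM h
  have hcard : M.det.natAbs = Nat.card ((ι → ℤ) ⧸ N) := by
    rw [← Submodule.natAbs_det_equiv N (LinearEquiv.ofInjective _ hinj), ← LinearMap.det_toLin']
    rfl
  have hfin : Finite ((ι → ℤ) ⧸ N) :=
    (Nat.card_ne_zero.1 (hcard ▸ Int.natAbs_ne_zero.2 hM)).2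
  have hrep : ∀ q : (ι → ℤ) ⧸ N, ∃ w : ι → ℤ, (∀ i, |(w i : ℝ)| ≤ L) ∧ N.mkQ w = q := by
    intro q
    obtain ⟨w, rfl⟩ := N.mkQ_surjective q
    let A : Matrix ι ι ℝ := M.map (Int.cast : ℤ → ℝ)
    have hA : IsUnit A.det := by
      have : A.det = (M.det : ℤ) := (Int.cast_det M).symm
      rw [this]
      simpa using hM
    let r : ι → ℝ := A⁻¹.mulVec fun i => (w i : ℝ)
    have hr : A.mulVec r = fun i => (w i : ℝ) := by
      rw [Matrix.mulVec_mulVec, Matrix.mul_nonsing_inv _ hA, Matrix.one_mulVec]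
    refine ⟨w - M.mulVec fun i => ⌊r i⌋, fun i => ?_, ?_⟩
    · have : (((w - M.mulVec fun i => ⌊r i⌋) i : ℤ) : ℝ) = ∑ j, (M i j : ℝ) * Int.fract (r j) := by
        have := congrFun hr i
        simp only [Matrix.mulVec, dotProduct, A, Matrix.map_apply] at this
        simp only [Pi.sub_apply, Matrix.mulVec, dotProduct, Int.cast_sub, Int.cast_sum,
          Int.cast_mul, Int.fract, mul_sub, Finset.sum_sub_distrib, this]
      rw [this]
      refine (Finset.abs_sum_le_sum_abs _ _).trans (le_trans ?_ (hL i))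
      refine Finset.sum_le_sum fun j _ => ?_
      rw [abs_mul, Int.abs_fract]
      exact mul_le_of_le_one_right (abs_nonneg _) (Int.fract_lt_one _).le
    · rw [map_sub, sub_eq_self, Submodule.mkQ_apply, Submodule.Quotient.mk_eq_zero]
      exact ⟨_, rfl⟩
  choose g hg hgq using hrep
  have : Fintype ((ι → ℤ) ⧸ N) := Fintype.ofFinite _
  refine ⟨Finset.univ.image g, ?_, ?_, ?_⟩
  · rw [Finset.card_image_of_injective _ (Function.LeftInverse.injective hgq), hcard,
      Nat.card_eq_fintype_card, Finset.card_univ]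
  · simp only [Finset.mem_image, Finset.mem_univ, true_and]
    rintro _ ⟨q, rfl⟩
    exact hg q
  · simp only [Finset.mem_image, Finset.mem_univ, true_and]
    rintro _ ⟨q, rfl⟩ _ ⟨q', rfl⟩ v hv
    have : N.mkQ (g q - g q') = 0 := by
      rw [hv, Submodule.mkQ_apply, Submodule.Quotient.mk_eq_zero]
      exact ⟨v, rfl⟩
    rw [map_sub, hgq, hgq, sub_eq_zero] at this
    rw [this]

/-! ### Lifts of points of `X_f` and the boundary of a finite set -/

section Lifts

variable {Γ : Type*}

/-- The `ℓ¹`-norm of `f`. -/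
noncomputable def l1Norm (f : MonoidAlgebra ℤ Γ) : ℝ := ∑ s ∈ f.coeff.support, |(f.coeff s : ℝ)|

theorem l1Norm_nonneg (f : MonoidAlgebra ℤ Γ) : 0 ≤ l1Norm f :=
  Finset.sum_nonneg fun _ _ => abs_nonneg _

variable [Group Γ]

/-- `Y w` is the right convolution of `w` with the `L¹`-inverse of `f`: it solves
`(Y w) f^* = w` and its sup norm is bounded by a multiple of that of `w`. -/
theorem exists_inverse_convolution {f : MonoidAlgebra ℤ Γ}
    (hunit : IsUnitL1 (fun γ => (f.coeff γ : ℂ))) :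
    ∃ B : ℝ, 0 ≤ B ∧ ∃ Y : (Γ → ℤ) → Γ → ℝ, ∀ (w : Γ → ℤ) (D : ℝ), (∀ γ, |(w γ : ℝ)| ≤ D) →
      (∀ γ, ∑ s ∈ f.coeff.support, (f.coeff s : ℝ) * Y w (γ * s) = w γ) ∧
      ∀ γ, |Y w γ| ≤ B * D := by
  classical
  obtain ⟨-, b, hb, hfb, -⟩ := hunit
  have hb' : Summable fun γ => ‖b γ‖ := by simpa using hb.summable (by simp)
  refine ⟨∑' γ, ‖b γ‖, tsum_nonneg fun _ => norm_nonneg _,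
    fun w γ => (∑' t, b t • (w (γ * t) : ℂ)).re, fun w D hw => ⟨fun γ => ?_, fun γ => ?_⟩⟩
  · have := sum_smul_tsum_smul f hb' (by convert hfb) (φ := fun t => (w (γ * t) : ℂ))
      (C := D) fun t => by simpa using hw (γ * t)
    have := congrArg Complex.re this
    rw [Complex.re_sum] at this
    simpa [mul_assoc] using this
  · refine (Complex.abs_re_le_norm _).trans ?_
    rw [← tsum_mul_right]
    refine tsum_of_norm_bounded (hb'.mul_right D).hasSum fun t => ?_
    rw [norm_smul]
    exact mul_le_mul_of_nonneg_left (by simpa using hw (γ * t)) (norm_nonneg _)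

open Classical in
/-- The right `K`-boundary of `F`: the elements `γ` of `F` with `γ K ⊈ F`. -/
noncomputable def rightBoundary (F K : Finset Γ) : Finset Γ := {γ ∈ F | ∃ s ∈ K, γ * s ∉ F}

open Classical in
theorem card_rightBoundary_le (F K : Finset Γ) :
    (rightBoundary F K).card ≤ K.card * ((F * K) ∆ F).card := by
  have hsub : rightBoundary F K ⊆ K.biUnion fun s => ((F * K) ∆ F).image (· * s⁻¹) := by
    intro γ hγ
    simp only [rightBoundary, Finset.mem_filter] at hγ
    obtain ⟨hF, s, hs, hn⟩ := hγ
    simp only [Finset.mem_biUnion, Finset.mem_image, Finset.mem_symmDiff]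
    exact ⟨s, hs, γ * s, Or.inl ⟨Finset.mul_mem_mul hF hs, hn⟩, by simp⟩
  refine (Finset.card_le_card hsub).trans (Finset.card_biUnion_le_card_mul _ _ _ fun s _ => ?_)
  exact Finset.card_image_le

theorem IsFolnerSeq.tendsto_rightBoundary {F : ℕ → Finset Γ} (hF : IsFolnerSeq F) {K : Finset Γ}
    (hK : K.Nonempty) :
    Filter.Tendsto (fun n => ((rightBoundary (F n) K).card : ℝ) / (F n).card) Filter.atTop
      (𝓝 0) := by
  classical
  have h := (hF.tendsto K hK).const_mul (K.card : ℝ)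
  rw [mul_zero] at h
  refine squeeze_zero (fun n => by positivity) (fun n => ?_) h
  rw [← mul_div_assoc]
  gcongr
  have := card_rightBoundary_le (F n) K
  norm_cast

open Classical in
/-- Sums over a row of `M_F`, rewritten as sums over the support of `f`; the arguments of `φ` are
an entry and its column. -/
theorem sum_compression_eq (f : MonoidAlgebra ℤ Γ) (F : Finset Γ) (γ : F) (φ : ℤ → Γ → ℝ)
    (hφ : ∀ γ, φ 0 γ = 0) :
    ∑ h : F, φ (compression f F γ h) h =
      ∑ s ∈ f.coeff.support with (γ : Γ) * s ∈ F, φ (f.coeff s) (γ * s) := by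
  classical
  have h1 : ∑ h : F, φ (compression f F γ h) h = ∑ h ∈ F, φ (f.coeff ((γ : Γ)⁻¹ * h)) h :=
    Finset.sum_coe_sort F fun h => φ (f.coeff ((γ : Γ)⁻¹ * h)) h
  rw [h1]
  symm
  refine Finset.sum_of_injOn (fun s => (γ : Γ) * s) (fun a _ b _ h => mul_left_cancel h) ?_ ?_ ?_
  · intro s hs
    simpa using (Finset.mem_filter.1 hs).2
  · intro h hh hn
    have : f.coeff ((γ : Γ)⁻¹ * h) = 0 := by
      by_contra h0
      refine hn ⟨(γ : Γ)⁻¹ * h, ?_, by simp⟩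
      simpa [h0] using hh
    rw [this, hφ]
  · intro s _
    simp

theorem sum_abs_compression_le (f : MonoidAlgebra ℤ Γ) (F : Finset Γ) (γ : F) :
    ∑ h : F, |(compression f F γ h : ℝ)| ≤ l1Norm f := by
  classical
  rw [sum_compression_eq f F γ (fun n _ => |(n : ℝ)|) (by simp)]
  exact Finset.sum_le_sum_of_subset_of_nonneg (Finset.filter_subset _ _)
    fun _ _ _ => abs_nonneg _

/-- If `y f^* = z` with `z` integral and `y` is nearly integral on `F`, then `z` agrees with
`M_F (round y)` off the boundary of `F`: the difference is an integer of absolute value `< 1`. -/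
theorem eq_compression_mulVec_of_near {f : MonoidAlgebra ℤ Γ} {F : Finset Γ} {z : Γ → ℤ}
    {y : Γ → ℝ} (hy : ∀ γ, ∑ s ∈ f.coeff.support, (f.coeff s : ℝ) * y (γ * s) = z γ)
    (hround : ∀ γ ∈ F, |y γ - round (y γ)| < 1 / (l1Norm f + 1))
    (γ : F) (hγ : (γ : Γ) ∉ rightBoundary F f.coeff.support) :
    z γ = (compression f F).mulVec (fun h => round (y h)) γ := by
  classical
  have hin : ∀ s ∈ f.coeff.support, (γ : Γ) * s ∈ F := by
    simpa [rightBoundary] using hγ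
  have h1 : ((compression f F).mulVec (fun h => round (y h)) γ : ℝ) =
      ∑ s ∈ f.coeff.support, (f.coeff s : ℝ) * round (y (γ * s)) := by
    have := sum_compression_eq f F γ (fun n h => (n : ℝ) * round (y h)) (by simp)
    rw [Finset.filter_true_of_mem hin] at this
    rw [← this]
    simp [Matrix.mulVec, dotProduct]
  have hL := l1Norm_nonneg f
  have h2 : |((z γ - (compression f F).mulVec (fun h => round (y h)) γ : ℤ) : ℝ)| < 1 := by
    rw [Int.cast_sub, h1, ← hy, ← Finset.sum_sub_distrib]
    calc _ ≤ ∑ s ∈ f.coeff.support, |(f.coeff s : ℝ)| * (1 / (l1Norm f + 1)) := by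
          refine (Finset.abs_sum_le_sum_abs _ _).trans (Finset.sum_le_sum fun s hs => ?_)
          rw [← mul_sub, abs_mul]
          exact mul_le_mul_of_nonneg_left (hround _ (hin s hs)).le (abs_nonneg _)
      _ = l1Norm f / (l1Norm f + 1) := by rw [← Finset.sum_mul, l1Norm, mul_one_div]
      _ < 1 := by rw [div_lt_one (by linarith)]; linarith
  rw [← Int.cast_abs] at h2
  exact sub_eq_zero.1 (Int.abs_lt_one_iff.1 (by exact_mod_cast h2))

theorem abs_compression_mulVec_round_le (f : MonoidAlgebra ℤ Γ) (F : Finset Γ)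
    {y : Γ → ℝ} {D : ℝ} (hD : 0 ≤ D) (hy : ∀ γ, |y γ| ≤ D) (γ : F) :
    |((compression f F).mulVec (fun h => round (y h)) γ : ℝ)| ≤ l1Norm f * (D + 1) := by
  have hr : ∀ h, |(round (y h) : ℝ)| ≤ D + 1 := fun h => by
    have h1 := abs_sub_round (y h)
    have h2 := hy h
    rw [abs_le] at *
    constructor <;> linarith
  simp only [Matrix.mulVec, dotProduct, Int.cast_sum, Int.cast_mul]
  calc _ ≤ ∑ h : F, |(compression f F γ h : ℝ)| * (D + 1) := by
        refine (Finset.abs_sum_le_sum_abs _ _).trans (Finset.sum_le_sum fun h _ => ?_)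
        rw [abs_mul]
        exact mul_le_mul_of_nonneg_left (hr h) (abs_nonneg _)
    _ ≤ _ := by
        rw [← Finset.sum_mul]
        exact mul_le_mul_of_nonneg_right (sum_abs_compression_le f F γ) (by linarith)

end Lifts

/-! ### Covers of `X_f` and separated points -/

/-- Infinite subcovers can be ignored in a lower bound for `minSubcover`, as they have
cardinality `⊤`. -/
theorem log_le_log_minSubcover {X : Type*} {U : Set (Set X)} {r : ℝ} (hr : 0 < r)
    (h : ∀ V ⊆ U, ⋃₀ V = Set.univ → V.Finite → r ≤ V.ncard) :
    (Real.log r : EReal) ≤ ENNReal.log ((minSubcover U : ℕ∞) : ℝ≥0∞) := by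
  have h1 : (⌈r⌉₊ : ℕ∞) ≤ minSubcover U := by
    refine le_iInf₂ fun V hVU => le_iInf fun hV => ?_
    by_cases hfin : V.Finite
    · rw [← hfin.cast_ncard_eq]
      exact_mod_cast Nat.ceil_le.2 (h V hVU hV hfin)
    · rw [Set.Infinite.encard_eq hfin]
      exact le_top
  have h2 : ENNReal.ofReal r ≤ ((minSubcover U : ℕ∞) : ℝ≥0∞) := by
    refine le_trans ?_ (ENat.toENNReal_le.2 h1)
    rw [ENat.toENNReal_coe, ← ENNReal.ofReal_natCast]
    exact ENNReal.ofReal_le_ofReal (Nat.le_ceil r)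
  refine le_trans (le_of_eq ?_) (ENNReal.log_monotone h2)
  rw [ENNReal.log_pos_real' (by rwa [ENNReal.toReal_ofReal hr.le]), ENNReal.toReal_ofReal hr.le]

variable {Γ : Type*} [Group Γ]

/-- The cover of `X_f` by the sets of points whose coordinate at `1` lies in a given open ball of
radius `ε / 2`. -/
def unitCover (f : MonoidAlgebra ℤ Γ) (ε : ℝ) : Set (Set (dualSystem f)) :=
  Set.range fun c : UnitAddCircle => {x | dist (x.1 1) c < ε / 2}

theorem isOpenCover_unitCover (f : MonoidAlgebra ℤ Γ) {ε : ℝ} (hε : 0 < ε) :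
    IsOpenCover (unitCover f ε) := by
  constructor
  · rintro _ ⟨c, rfl⟩
    have : Continuous fun x : dualSystem f => x.1 1 :=
      (continuous_apply 1).comp continuous_subtype_val
    exact isOpen_lt (this.dist continuous_const) continuous_const
  · refine Set.eq_univ_of_forall fun x => ⟨_, ⟨x.1 1, rfl⟩, ?_⟩
    simpa using hε

theorem dist_lt_of_mem_coverJoin {f : MonoidAlgebra ℤ Γ} {ε : ℝ} {F : Finset Γ}
    {W : Set (dualSystem f)} (hW : W ∈ coverJoin F (unitCover f ε)) {x x' : dualSystem f}
    (hx : x ∈ W) (hx' : x' ∈ W) {γ : Γ} (hγ : γ ∈ F) : dist (x.1 γ) (x'.1 γ) < ε := by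
  obtain ⟨u, hu, rfl⟩ := hW
  obtain ⟨c, hc⟩ := hu γ hγ
  have key : ∀ z ∈ ⋂ γ ∈ F, γ • u γ, dist (z.1 γ) c < ε / 2 := by
    intro z hz
    have hz := Set.mem_iInter₂.1 hz γ hγ
    rw [Set.mem_smul_set_iff_inv_smul_mem, ← hc] at hz
    have h1 : (γ⁻¹ • z).1 1 = z.1 γ := by
      change z.1 (γ⁻¹⁻¹ * 1) = _
      simp
    rw [← h1]
    exact hz
  linarith [dist_triangle_right (x.1 γ) (x'.1 γ) c, key x hx, key x' hx']

/-- A real solution of `y f^* = w` with `w` integral reduces modulo `1` to a point of `X_f`. -/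
theorem coe_mem_dualSystem {f : MonoidAlgebra ℤ Γ} {y : Γ → ℝ} {w : Γ → ℤ}
    (hy : ∀ γ, ∑ s ∈ f.coeff.support, (f.coeff s : ℝ) * y (γ * s) = w γ) :
    (fun γ => (y γ : UnitAddCircle)) ∈ dualSystem f := by
  change mulStarRight f _ = 0
  ext γ
  change ∑ s ∈ f.coeff.support, f.coeff s • (y (γ * s) : UnitAddCircle) = 0
  have h : ∑ s ∈ f.coeff.support, f.coeff s • (y (γ * s) : UnitAddCircle) =
      ((∑ s ∈ f.coeff.support, (f.coeff s : ℝ) * y (γ * s) : ℝ) : UnitAddCircle) := by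
    rw [← QuotientAddGroup.mk'_apply, map_sum]
    refine Finset.sum_congr rfl fun s _ => ?_
    rw [← zsmul_eq_mul, map_zsmul]
    rfl
  rw [h, hy, AddCircle.coe_eq_zero_iff]
  exact ⟨w γ, by simp⟩

/-- If the elements of `W` are distinct modulo `M ℤ^ι`, but each is congruent to `w₀` up to an
integer vector supported on `T` and bounded by `C`, then `W` is no larger than the set of these
vectors. -/
theorem card_le_pow_of_residual_support {ι : Type*} [Fintype ι] [DecidableEq ι] {M : Matrix ι ι ℤ}
    {W : Finset (ι → ℤ)} (hW : ∀ w ∈ W, ∀ w' ∈ W, ∀ v, w - w' = M.mulVec v → w = w')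
    (w₀ : ι → ℤ) (T : Finset ι) (C : ℕ)
    (h : ∀ w ∈ W, ∃ v, (∀ i ∉ T, (w - w₀ - M.mulVec v) i = 0) ∧
      ∀ i, |(w - w₀ - M.mulVec v) i| ≤ C) :
    W.card ≤ (2 * C + 1) ^ T.card := by
  choose! v hv0 hvC using h
  have hcard : (Fintype.piFinset fun _ : T => Finset.Icc (-(C : ℤ)) (C : ℤ)).card =
      (2 * C + 1) ^ T.card := by
    simp only [Fintype.card_piFinset, Finset.prod_const, Int.card_Icc, Finset.card_univ,
      Fintype.card_coe]
    congr 1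
    omega
  rw [← hcard]
  refine Finset.card_le_card_of_injOn
    (fun w i => (w - w₀ - M.mulVec (v w)) (i : ι)) (fun w hw => ?_) fun w hw w' hw' heq => ?_
  · exact Fintype.mem_piFinset.2 fun i => Finset.mem_Icc.2 (abs_le.1 (hvC w hw i))
  · refine hW w hw w' hw' (v w - v w') ?_
    have : w - w₀ - M.mulVec (v w) = w' - w₀ - M.mulVec (v w') := by
      ext i
      by_cases hi : i ∈ T
      · exact congrFun heq ⟨i, hi⟩
      · rw [hv0 w hw i hi, hv0 w' hw' i hi]
    rw [Matrix.mulVec_sub]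
    have h2 : w - w₀ - M.mulVec (v w) - (w' - w₀ - M.mulVec (v w')) = 0 := sub_eq_zero.2 this
    rw [← sub_eq_zero, ← h2]
    abel

/-- `det M_F ≤ N(U^F) (2C + 1)^|∂F|` with `C` independent of `F`. The points of `X_f` given by the
bounded representatives of `ℤ^F / M_F ℤ^F` are distributed over the elements of the subcover `V`,
and each element receives at most `(2C + 1)^|∂F|` of them. -/
theorem exists_det_le_ncard {f : MonoidAlgebra ℤ Γ} [DecidableEq Γ]
    (hunit : IsUnitL1 (fun γ => (f.coeff γ : ℂ))) :
    ∃ C : ℕ, ∀ F : Finset Γ, (compression f F).det ≠ 0 →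
      ∀ V ⊆ coverJoin F (unitCover f (1 / (l1Norm f + 1))), ⋃₀ V = Set.univ → V.Finite →
        (compression f F).det.natAbs ≤
          V.ncard * (2 * C + 1) ^ (rightBoundary F f.coeff.support).card := by
  obtain ⟨B, hB, Y, hY⟩ := exists_inverse_convolution hunit
  set L := l1Norm f with hL
  have hL0 : 0 ≤ L := l1Norm_nonneg f
  refine ⟨⌈2 * L + L * (2 * (B * L) + 1)⌉₊, fun F hdet V hVU hV hfin => ?_⟩
  -- The first summand bounds `w - w'`, the second one `M_F v`, as the lifts of two points
  -- differ by at most `2 B L` and rounding adds at most `1`.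
  set C := ⌈2 * L + L * (2 * (B * L) + 1)⌉₊
  obtain ⟨W, hWcard, hWL, hW⟩ := exists_representatives _ hdet
    (fun γ => sum_abs_compression_le f F γ)
  let ext : (F → ℤ) → Γ → ℤ := fun w γ => if h : γ ∈ F then w ⟨γ, h⟩ else 0
  have ext_apply : ∀ (w : F → ℤ) (γ : F), ext w γ = w γ := fun w γ => by simp [ext]
  have hext : ∀ w ∈ W, ∀ γ, |(ext w γ : ℝ)| ≤ L := fun w hw γ => by
    by_cases h : γ ∈ F
    · simpa [ext, h] using hWL w hw ⟨γ, h⟩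
    · simpa [ext, h] using hL0
  have hpt : ∀ w ∈ W, ∃ x : dualSystem f, ∀ γ, x.1 γ = (Y (ext w) γ : UnitAddCircle) :=
    fun w hw => ⟨⟨_, coe_mem_dualSystem (hY _ L (hext w hw)).1⟩, fun _ => rfl⟩
  choose! x hx using hpt
  have hmem : ∀ w, ∃ u ∈ V, x w ∈ u := fun w =>
    Set.mem_sUnion.1 (hV ▸ Set.mem_univ (x w))
  choose g hgV hg using hmem
  rw [← hWcard, Set.ncard_eq_toFinset_card V hfin, mul_comm]
  refine Finset.card_le_mul_card_image_of_maps_to (f := g)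
    (fun w _ => by simpa using hgV w) _ fun u _ => ?_
  rcases (W.filter fun w => g w = u).eq_empty_or_nonempty with he | ⟨w₀, hw₀⟩
  · rw [he]; simp
  rw [Finset.mem_filter] at hw₀
  let T : Finset F := {γ | (γ : Γ) ∈ rightBoundary F f.coeff.support}
  have hT : T.card ≤ (rightBoundary F f.coeff.support).card :=
    Finset.card_le_card_of_injOn Subtype.val (fun γ hγ => by simpa [T] using hγ)
      Subtype.val_injective.injOn
  refine le_trans ?_ (Nat.pow_le_pow_right (Nat.succ_pos _) hT)
  refine card_le_pow_of_residual_support (M := compression f F)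
    (fun w hw w' hw' => hW w (Finset.mem_filter.1 hw).1 w' (Finset.mem_filter.1 hw').1)
    w₀ T C fun w hw => ?_
  rw [Finset.mem_filter] at hw
  obtain ⟨hYw, hBw⟩ := hY _ L (hext w hw.1)
  obtain ⟨hYw₀, hBw₀⟩ := hY _ L (hext w₀ hw₀.1)
  have hy : ∀ γ, ∑ s ∈ f.coeff.support, (f.coeff s : ℝ) *
      (Y (ext w) - Y (ext w₀)) (γ * s) = ((ext w γ - ext w₀ γ : ℤ) : ℝ) := fun γ => by
    simp only [Pi.sub_apply, mul_sub, Finset.sum_sub_distrib, hYw, hYw₀, Int.cast_sub]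
  have hyB : ∀ γ, |(Y (ext w) - Y (ext w₀)) γ| ≤ 2 * (B * L) := fun γ => by
    have := abs_sub (Y (ext w) γ) (Y (ext w₀) γ)
    have h1 := hBw γ
    have h2 := hBw₀ γ
    rw [Pi.sub_apply]
    linarith
  have hround : ∀ γ ∈ F, |(Y (ext w) - Y (ext w₀)) γ - round ((Y (ext w) - Y (ext w₀)) γ)| <
      1 / (L + 1) := fun γ hγ => by
    have hd := dist_lt_of_mem_coverJoin (hVU (hgV w)) (hg w)
      (show x w₀ ∈ g w by rw [hw.2, ← hw₀.2]; exact hg w₀) hγ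
    rw [hx w hw.1, hx w₀ hw₀.1, dist_eq_norm, ← AddCircle.coe_sub, UnitAddCircle.norm_eq] at hd
    exact hd
  refine ⟨fun h => round ((Y (ext w) - Y (ext w₀)) h), fun γ hγ => ?_, fun γ => ?_⟩
  · have := eq_compression_mulVec_of_near hy hround γ (by simpa [T] using hγ)
    rw [ext_apply, ext_apply] at this
    rw [Pi.sub_apply, ← this]
    simp
  · have h1 := abs_compression_mulVec_round_le f F (by positivity) hyB γ
    have h2 := hWL w hw.1 γ
    have h3 := hWL w₀ hw₀.1 γ
    have h4 := Nat.le_ceil (2 * L + L * (2 * (B * L) + 1))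
    have h5 : (|(w - w₀ - (compression f F).mulVec
        (fun h => round ((Y (ext w) - Y (ext w₀)) h))) γ| : ℝ) ≤ (C : ℝ) := by
      refine le_trans ?_ h4
      simp only [Pi.sub_apply, Int.cast_sub] at h1 ⊢
      rw [abs_le] at *
      constructor <;> linarith
    exact_mod_cast h5

/-! ### The entropy inequality -/

/-- The logarithm of the determinant is already bounded by the entropy of the single cover of `X_f`
by balls in the coordinate at `1` of radius `1 / (2 (‖f‖₁ + 1))`. -/
theorem log_fkDet_le_coverEntropyOf {F : ℕ → Finset Γ} (hF : IsFolnerSeq F)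
    {f : MonoidAlgebra ℤ Γ} (hunit : IsUnitL1 (fun γ => (f.coeff γ : ℂ)))
    (hpos : (toGroupVN f : L2 Γ →L[ℂ] L2 Γ).IsPositive) :
    (Real.log (fkDet (toGroupVN f)) : EReal) ≤
      coverEntropyOf F (unitCover f (1 / (l1Norm f + 1))) := by
  classical
  have hu := isUnit_toGroupVN hunit hpos.isSelfAdjoint
  rw [log_fkDet hpos hu]
  set a := (vnTrace
    (CFC.log (toGroupVN f : L2 Γ →L[ℂ] L2 Γ))).re
  have hK : f.coeff.support.Nonempty := by
    rw [Finset.nonempty_iff_ne_empty, Ne, Finsupp.support_eq_empty]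
    intro h0
    obtain ⟨-, b, -, hfb, -⟩ := hunit
    have := congrFun hfb 1
    simp [conv, h0] at this
  obtain ⟨C, hC⟩ := exists_det_le_ncard hunit
  set β : ℕ → ℝ := fun n => ((rightBoundary (F n) f.coeff.support).card : ℝ)
  have hlim : Filter.Tendsto
      (fun n => ((a - β n / (F n).card * Real.log (2 * C + 1) : ℝ) : EReal)) Filter.atTop
      (𝓝 (a : EReal)) := by
    refine (continuous_coe_real_ereal.tendsto a).comp ?_
    simpa using ((hF.tendsto_rightBoundary hK).mul_const (Real.log (2 * C + 1))).const_sub a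
  rw [← hlim.liminf_eq]
  refine Filter.liminf_le_liminf (Filter.Eventually.of_forall fun n => ?_)
  have hcard : 0 < ((F n).card : ℝ) := by exact_mod_cast (hF.nonempty n).card_pos
  have hC0 : (0 : ℝ) < 2 * C + 1 := by positivity
  have hdet := exp_vnTrace_log_le_det hpos hu (F n)
  have hdet0 : 0 < (compression f (F n)).det := by
    exact_mod_cast (Real.exp_pos _).trans_le hdet
  -- `hdet` and `hC` give `N(U^F) ≥ exp (a |F|) / (2C + 1)^|∂F|` for `F = F n`.
  have hlog := log_le_log_minSubcover
    (U := coverJoin (F n) (unitCover f (1 / (l1Norm f + 1))))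
    (r := Real.exp ((F n).card * a) / Real.exp (β n * Real.log (2 * C + 1)))
    (by positivity) fun V hVU hV hfin => by
      have h1 := hC (F n) hdet0.ne' V hVU hV hfin
      have h2 : ((compression f (F n)).det : ℝ) ≤
          V.ncard * (2 * C + 1) ^ (rightBoundary (F n) f.coeff.support).card := by
        rw [← Int.natAbs_of_nonneg hdet0.le]
        exact_mod_cast h1
      rw [div_le_iff₀ (Real.exp_pos _), mul_comm (β n), Real.exp_mul (Real.log _),
        Real.exp_log hC0, Real.rpow_natCast]
      exact hdet.trans h2
  rw [← Real.exp_sub, Real.log_exp] at hlog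
  have : a - β n / (F n).card * Real.log (2 * C + 1) =
      ((F n).card * a - β n * Real.log (2 * C + 1)) / (F n).card := by
    field_simp
  rw [this, EReal.coe_div]
  exact EReal.div_le_div_right_of_nonneg (by exact_mod_cast hcard.le) hlog

end Deninger

theorem theorem10 {Γ : Type*} [Group Γ] [Group.FG Γ]
    (F : ℕ → Finset Γ) (hF : Deninger.IsFolnerSeq F)
    (f : MonoidAlgebra ℤ Γ)
    (hunit : Deninger.IsUnitL1 (fun γ => (f.coeff γ : ℂ)))
    (hpos : (Deninger.toGroupVN f : Deninger.L2 Γ →L[ℂ] Deninger.L2 Γ).IsPositive) :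
    ((Real.log (Deninger.fkDet (Deninger.toGroupVN f)) : ℝ) : EReal) ≤
      Deninger.topEntropy F (Deninger.dualSystem f) := by
  have hε : 0 < 1 / (Deninger.l1Norm f + 1) :=
    one_div_pos.2 (by linarith [Deninger.l1Norm_nonneg f])
  exact (Deninger.log_fkDet_le_coverEntropyOf hF hunit hpos).trans
    (le_iSup₂ (f := fun U _ => Deninger.coverEntropyOf F U) _
      (Deninger.isOpenCover_unitCover f hε))
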